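/- Let $\mathbf{FinStoch}_{\{1,0\}}$ be the category whose objects are the powers $\mathbb{B}^n=\{1,0\}^n$ ($n\ge 0$) and whose morphisms $f\colon\mathbb{B}^n\to\mathbb{B}^m$ assign to each $a\in\{1,0\}^n$ a probability distribution $f(\cdot\mid a)$ on $\{1,0\}^m$. Composition is $(f;g)(c\mid a)=\sum_b g(c\mid b)f(b\mid a)$. The monoidal product is $\mathbb{B}^n\otimes\mathbb{B}^k=\mathbb{B}^{n+k}$ on objects and $(f\otimes g)(b,d\mid a,c)=f(b\mid a)\,g(d\mid c)$ on morphisms, with unit $I=\mathbb{B}^0$. For $p\in[0,1]$ let $\langle p\rangle\colon I\to\mathbb{B}$ be the distribution $p|1\rangle+(1-p)|0\rangle$. For $X=\mathbb{B}^m$ let $\phi_X\colon X\otimes\mathbb{B}\otimes X\to X$ be given by $\phi_X(a,1,b)=|a\rangle$ and $\phi_X(a,0,b)=|b\rangle$, and let $\phi^p_X=(\mathrm{id}_X\otimes\langle p\rangle\otimes\mathrm{id}_X);\phi_X\colon X\otimes X\to X$. For $f,g\colon\mathbb{B}^n\to\mathbb{B}^m$ put \[ d(f,g)=\max_{a\in\{1,0\}^n}\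 \tfrac12\sum_{b\in\{1,0\}^m}|f(b\mid a)-g(b\mid a)| . \] Consider judgments $f\equiv_\delta g$ between morphisms $f,g$ of $\mathbf{FinStoch}_{\{1,0\}}$ of the same type, with $\delta\in\mathbb{R}$, generated inductively by the following rules, for all morphisms of suitable types: 1. $f\equiv_0 f$ and $f\equiv_1 g$; 2. if $f\equiv_\delta g$, then $g\equiv_\delta f$; 3. if $f\equiv_\delta g$ and $g\equiv_{\delta'}h$, then $f\equiv_{\delta+\delta'}h$; 4. if $f\equiv_\delta g$ and $\delta\le\delta'$, then $f\equiv_{\delta'}g$; 5. if $f\equiv_\delta f'$, then $f;g\equiv_\delta f';g$ and $f\otimes g\equiv_\delta f'\otimes g$; if $g\equiv_\delta g'$, then $f;g\equiv_\delta f;g'$ and $f\otimes g\equiv_\delta f\otimes g'$; 6. if $f\equiv_\delta f'$ and $g\equiv_\delta g'$, where $f,f',g,g'$ have codomain $X$, then $(f\otimes\mathrm{id}_{\mathbb{B}}\otimes g);\phi_X\equiv_\delta(f'\otimes\mathrm{id}_{\mathbb{B}}\otimes g');\phi_X$; 7. if $f\equiv_\delta f'$ and $g\equiv_\gamma g'$,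 where $f,f',g,g'$ have codomain $X$, and $p\in[0,1]$, then $(f\otimes g);\phi^p_X\equiv_{p\delta+(1-p)\gamma}(f'\otimes g');\phi^p_X$. Then the proof system is sound and complete: for all morphisms $f,g$ of the same type, - (soundness) if $f\equiv_\delta g$ is derivable, then $d(f,g)\le\delta$; - (completeness) $f\equiv_{d(f,g)}g$ is derivable. -/

import Mathlib

noncomputable section

namespace FinStochBool

/-- The set `{1,0}ⁿ`, the `n`-th power of the Booleans (`true` is `1`, `false` is `0`).
These are the objects of `FinStoch_{1,0}`; the object is recorded by the exponent `n`, the monoidal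
unit is `0`, the object `𝔹` is `1`, and the (strict) monoidal product of `n` and `m` is `n + m`. -/
abbrev Bits (n : ℕ) : Type := Fin n → Bool

/-- The first `n` bits of a word of `n + m` bits. -/
def fstBits {n m : ℕ} (x : Bits (n + m)) : Bits n := fun i => x (Fin.castAdd m i)

/-- The last `m` bits of a word of `n + m` bits. -/
def sndBits {n m : ℕ} (x : Bits (n + m)) : Bits m := fun i => x (Fin.natAdd n i)

theorem sum_bits_add {n m : ℕ} (F : Bits n → Bits m → ℝ) :
    ∑ y : Bits (n + m), F (fstBits y) (sndBits y) = ∑ u : Bits n, ∑ v : Bits m, F u v := by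
  rw [← Fintype.sum_prod_type']
  refine Fintype.sum_equiv (Fin.appendEquiv n m).symm _ _ ?_
  intro y
  rfl

/-- Morphisms `{1,0}ⁿ → {1,0}ᵐ` of `FinStoch_{1,0}`: maps sending every `a ∈ {1,0}ⁿ` to a
probability distribution on `{1,0}ᵐ`. We write `f.prob a b` for the probability `f(b | a)`. -/
@[ext]
structure Hom (n m : ℕ) where
  prob : Bits n → Bits m → ℝ
  nonneg : ∀ a b, 0 ≤ prob a b
  sum_one : ∀ a, ∑ b, prob a b = 1

/-- The stochastic map `a ↦ |F a⟩` of a function `F`. -/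
def det {n m : ℕ} (F : Bits n → Bits m) : Hom n m where
  prob a b := if b = F a then 1 else 0
  nonneg a b := by split_ifs <;> norm_num
  sum_one a := by simp

/-- The identity `a ↦ |a⟩`. -/
def ident (n : ℕ) : Hom n n := det fun a => a

/-- Composition in diagrammatic order: `(f ; g)(c | a) = ∑ b, g(c | b) f(b | a)`. -/
def comp {n m k : ℕ} (f : Hom n m) (g : Hom m k) : Hom n k where
  prob a c := ∑ b, g.prob b c * f.prob a b
  nonneg a c := Finset.sum_nonneg fun b _ => mul_nonneg (g.nonneg b c) (f.nonneg a b)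
  sum_one a := by
    rw [Finset.sum_comm]
    simp [← Finset.sum_mul, g.sum_one, f.sum_one]

/-- The monoidal product: `(f ⊗ g)(b, d | a, c) = f(b | a) g(d | c)`. -/
def tensor {n m k l : ℕ} (f : Hom n m) (g : Hom k l) : Hom (n + k) (m + l) where
  prob x y := f.prob (fstBits x) (fstBits y) * g.prob (sndBits x) (sndBits y)
  nonneg x y := mul_nonneg (f.nonneg _ _) (g.nonneg _ _)
  sum_one x := by
    rw [sum_bits_add fun u v => f.prob (fstBits x) u * g.prob (sndBits x) v]
    simp [← Finset.mul_sum, f.sum_one, g.sum_one]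

/-- The weighted coin `⟨p⟩ : I → 𝔹`, namely `p |1⟩ + (1 - p) |0⟩`. -/
def coin (p : unitInterval) : Hom 0 1 where
  prob _ b := if b 0 = true then (p : ℝ) else 1 - (p : ℝ)
  nonneg _ b := by
    split_ifs
    · exact p.2.1
    · exact sub_nonneg.2 p.2.2
  sum_one _ := by
    rw [← Fintype.sum_equiv (Equiv.funUnique (Fin 1) Bool).symm
      (fun b : Bool => if b = true then (p : ℝ) else 1 - (p : ℝ)) _ (fun b => rfl)]
    simp

/-- The if-gate `φ_X : X ⊗ 𝔹 ⊗ X → X` at `X = {1,0}ᵐ`: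
`φ(a, 1, b) = |a⟩` and `φ(a, 0, b) = |b⟩`. -/
def phi (m : ℕ) : Hom (m + 1 + m) m :=
  det fun x => if sndBits (fstBits x) 0 = true then fstBits (fstBits x) else sndBits x

/-- Probabilistic choice `φ_Xᵖ = (id_X ⊗ ⟨p⟩ ⊗ id_X) ; φ_X : X ⊗ X → X` at `X = {1,0}ᵐ`
(the domain `m + 0 + m` is `m + m` by definition of addition). -/
def phiP (p : unitInterval) (m : ℕ) : Hom (m + m) m :=
  comp (tensor (tensor (ident m) (coin p)) (ident m) : Hom (m + 0 + m) (m + 1 + m)) (phi m)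

/-- Total variation distance between two distributions on `{1,0}ᵐ`. -/
def tv {m : ℕ} (v w : Bits m → ℝ) : ℝ := ∑ b, |v b - w b| / 2

/-- The distance between morphisms: the maximum over the inputs of the total variation distance of
the output distributions. -/
def dist {n m : ℕ} (f g : Hom n m) : ℝ :=
  Finset.univ.sup' Finset.univ_nonempty fun a : Bits n => tv (f.prob a) (g.prob a)

/-- The quantitative proof system: `Derivable δ f g` is the judgment `f ≡_δ g`. -/
inductive Derivable : {n m : ℕ} → ℝ → Hom n m → Hom n m → Prop
  | refl {n m : ℕ} (f : Hom n m) : Derivable 0 f f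
  | top {n m : ℕ} (f g : Hom n m) : Derivable 1 f g
  | symm {n m : ℕ} {δ : ℝ} {f g : Hom n m} : Derivable δ f g → Derivable δ g f
  | triangle {n m : ℕ} {δ δ' : ℝ} {f g h : Hom n m} :
      Derivable δ f g → Derivable δ' g h → Derivable (δ + δ') f h
  | weaken {n m : ℕ} {δ δ' : ℝ} {f g : Hom n m} :
      Derivable δ f g → δ ≤ δ' → Derivable δ' f g
  | compLeft {n m k : ℕ} {δ : ℝ} {f f' : Hom n m} (g : Hom m k) :
      Derivable δ f f' → Derivable δ (comp f g) (comp f' g)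
  | compRight {n m k : ℕ} {δ : ℝ} (f : Hom n m) {g g' : Hom m k} :
      Derivable δ g g' → Derivable δ (comp f g) (comp f g')
  | tensorLeft {n m k l : ℕ} {δ : ℝ} {f f' : Hom n m} (g : Hom k l) :
      Derivable δ f f' → Derivable δ (tensor f g) (tensor f' g)
  | tensorRight {n m k l : ℕ} {δ : ℝ} (f : Hom n m) {g g' : Hom k l} :
      Derivable δ g g' → Derivable δ (tensor f g) (tensor f g')
  | phi {n k m : ℕ} {δ : ℝ} {f f' : Hom n m} {g g' : Hom k m} :
      Derivable δ f f' → Derivable δ g g' →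
      Derivable δ (comp (tensor (tensor f (ident 1)) g) (phi m))
        (comp (tensor (tensor f' (ident 1)) g') (phi m))
  | phiP {n k m : ℕ} {δ γ : ℝ} (p : unitInterval) {f f' : Hom n m} {g g' : Hom k m} :
      Derivable δ f f' → Derivable γ g g' →
      Derivable ((p : ℝ) * δ + (1 - (p : ℝ)) * γ) (comp (tensor f g) (phiP p m))
        (comp (tensor f' g') (phiP p m))

end FinStochBool

end

noncomputable section

namespace FinStochBool

/-! Soundness is an induction on derivations, proved input by input: total variation is a metric
bounded by 1, stochastic maps do not increase it, tensoring with a fixed morphism preserves it, and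
it is jointly convex (`Derivable.sound`).

Completeness is the maximal coupling argument. Let p = d(f, g) with 0 < p < 1. At input a, min(f, g)
has mass 1 - tv ≥ 1 - p, so its normalization u satisfies (1 - p) u ≤ min(f, g)
(`one_sub_dist_mul_overlap_le`). Hence f = p r + (1 - p) u and g = p s + (1 - p) u with the same u.
Copying the input and applying the choice rule once, to r ≡_1 s and u ≡_0 u, gives f ≡_p g. -/

theorem sum_bits_one (F : Bits 1 → ℝ) :
    ∑ b : Bits 1, F b = F (fun _ => true) + F (fun _ => false) := by
  rw [← Fintype.sum_equiv (Equiv.funUnique (Fin 1) Bool).symm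
    (fun b : Bool => F (fun _ => b)) _ (fun b => rfl)]
  simp

theorem bits_one_eq (z : Bits 1) : z = fun _ => z 0 := by
  funext i
  rw [Subsingleton.elim i 0]

theorem comp_det_prob {n m k : ℕ} (F : Bits n → Bits m) (g : Hom m k) (a : Bits n) (c : Bits k) :
    (comp (det F) g).prob a c = g.prob (F a) c := by
  simp [comp, det]

/-- Running `f` and `g` side by side and then the if-gate selects one of the two outputs. -/
theorem ifGate_prob {n k m : ℕ} (f : Hom n m) (g : Hom k m) (x : Bits (n + 1 + k)) (c : Bits m) :
    (comp (tensor (tensor f (ident 1)) g) (phi m)).prob x c =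
      if sndBits (fstBits x) 0 = true then f.prob (fstBits (fstBits x)) c
      else g.prob (sndBits x) c := by
  have h1 := sum_bits_add (n := m + 1) (m := m) fun u v =>
    (if c = if sndBits u 0 = true then fstBits u else v then (1 : ℝ) else 0) *
      (f.prob (fstBits (fstBits x)) (fstBits u) *
        (ident 1).prob (sndBits (fstBits x)) (sndBits u) * g.prob (sndBits x) v)
  have h2 := sum_bits_add (n := m) (m := 1) fun a s => ∑ v,
    (if c = if s 0 = true then a else v then (1 : ℝ) else 0) *
      (f.prob (fstBits (fstBits x)) a *
        (ident 1).prob (sndBits (fstBits x)) s * g.prob (sndBits x) v)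
  refine (h1.trans h2).trans ?_
  rw [bits_one_eq (sndBits (fstBits x))]
  cases sndBits (fstBits x) 0 <;>
    simp [sum_bits_one, ident, det, funext_iff (α := Fin 1), ← Finset.mul_sum, ← Finset.sum_mul,
      f.sum_one, g.sum_one]

theorem phiP_prob (p : unitInterval) {m : ℕ} (x : Bits (m + m)) (c : Bits m) :
    (phiP p m).prob x c = p * (if c = fstBits x then 1 else 0) +
      (1 - p) * (if c = sndBits x then 1 else 0) := by
  have h1 := sum_bits_add (n := m + 1) (m := m) fun u v =>
    (if c = if sndBits u 0 = true then fstBits u else v then (1 : ℝ) else 0) *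
      ((ident m).prob (fstBits x) (fstBits u) *
        (coin p).prob (fun i => i.elim0) (sndBits u) * (ident m).prob (sndBits x) v)
  have h2 := sum_bits_add (n := m) (m := 1) fun a s => ∑ v,
    (if c = if s 0 = true then a else v then (1 : ℝ) else 0) *
      ((ident m).prob (fstBits x) a *
        (coin p).prob (fun i => i.elim0) s * (ident m).prob (sndBits x) v)
  refine Eq.trans ?_ ((h1.trans h2).trans ?_)
  -- The coin ignores its input and `m + 0 + m` reduces to `m + m`, so unfolding `phiP` gives
  -- exactly the left side of `h1`.
  · rfl
  · simp [sum_bits_one, ident, det, coin, Finset.sum_add_distrib]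

/-- Running `f` and `g` side by side and then the choice gate gives their convex combination. -/
theorem choice_prob (p : unitInterval) {n k m : ℕ} (f : Hom n m) (g : Hom k m)
    (x : Bits (n + k)) (c : Bits m) :
    (comp (tensor f g) (phiP p m)).prob x c =
      p * f.prob (fstBits x) c + (1 - p) * g.prob (sndBits x) c := by
  have h := sum_bits_add (n := m) (m := m) fun u v =>
    (p * (if c = u then (1 : ℝ) else 0) + (1 - p) * (if c = v then 1 else 0)) *
      (f.prob (fstBits x) u * g.prob (sndBits x) v)
  simp only [comp, phiP_prob]
  refine h.trans ?_
  simp only [add_mul, Finset.sum_add_distrib]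
  congr 1
  · simp [← Finset.mul_sum, g.sum_one]
  · simp [← Finset.sum_mul, ← Finset.mul_sum, f.sum_one, mul_left_comm]

/-! ### Total variation distance -/

theorem tv_self {m : ℕ} (v : Bits m → ℝ) : tv v v = 0 := by simp [tv]

theorem tv_nonneg {m : ℕ} (v w : Bits m → ℝ) : 0 ≤ tv v w :=
  Finset.sum_nonneg fun _ _ => by positivity

theorem tv_comm {m : ℕ} (v w : Bits m → ℝ) : tv v w = tv w v := by
  simp only [tv, abs_sub_comm]

theorem tv_triangle {m : ℕ} (u v w : Bits m → ℝ) : tv u w ≤ tv u v + tv v w := by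
  rw [tv, tv, tv, ← Finset.sum_add_distrib]
  refine Finset.sum_le_sum fun b _ => ?_
  linarith [abs_sub_le (u b) (v b) (w b)]

theorem tv_prob_le_one {n m : ℕ} (f g : Hom n m) (a : Bits n) : tv (f.prob a) (g.prob a) ≤ 1 := by
  have h : ∑ b, (f.prob a b + g.prob a b) / 2 = 1 := by
    rw [← Finset.sum_div, Finset.sum_add_distrib, f.sum_one, g.sum_one]
    norm_num
  rw [← h]
  refine Finset.sum_le_sum fun b _ => ?_
  have := f.nonneg a b
  have := g.nonneg a b
  have : |f.prob a b - g.prob a b| ≤ f.prob a b + g.prob a b := by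
    rw [abs_le]
    constructor <;> linarith
  linarith

/-- A mixture of distances bounds the distance of the mixtures. -/
theorem tv_sum_mul_le {m : ℕ} {ι : Type*} [Fintype ι] (r : ι → ℝ) (hr : ∀ i, 0 ≤ r i)
    (v w : ι → Bits m → ℝ) :
    tv (fun c => ∑ i, r i * v i c) (fun c => ∑ i, r i * w i c) ≤ ∑ i, r i * tv (v i) (w i) := by
  simp only [tv, Finset.mul_sum]
  rw [Finset.sum_comm]
  refine Finset.sum_le_sum fun c _ => ?_
  rw [← Finset.sum_sub_distrib]
  simp only [mul_div_assoc']
  rw [← Finset.sum_div]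
  refine div_le_div_of_nonneg_right ((Finset.abs_sum_le_sum_abs _ _).trans_eq ?_) zero_le_two
  exact Finset.sum_congr rfl fun i _ => by rw [← mul_sub, abs_mul, abs_of_nonneg (hr i)]

/-- Data processing: apply the triangle inequality for each output c, then sum over c using ∑ c, g(c
| b) = 1. -/
theorem tv_comp_left_le {n m k : ℕ} (f f' : Hom n m) (g : Hom m k) (a : Bits n) :
    tv ((comp f g).prob a) ((comp f' g).prob a) ≤ tv (f.prob a) (f'.prob a) := by
  have h : ∑ b, |f.prob a b - f'.prob a b| / 2 =
      ∑ c, ∑ b, g.prob b c * |f.prob a b - f'.prob a b| / 2 := by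
    rw [Finset.sum_comm]
    simp only [mul_div_assoc, ← Finset.sum_mul, g.sum_one, one_mul]
  rw [tv, tv, h]
  refine Finset.sum_le_sum fun c _ => ?_
  rw [← Finset.sum_div]
  refine div_le_div_of_nonneg_right ?_ zero_le_two
  simp only [comp]
  rw [← Finset.sum_sub_distrib]
  refine (Finset.abs_sum_le_sum_abs _ _).trans_eq ?_
  exact Finset.sum_congr rfl fun b _ => by rw [← mul_sub, abs_mul, abs_of_nonneg (g.nonneg b c)]

theorem tv_comp_right_le {n m k : ℕ} (f : Hom n m) {g g' : Hom m k} {δ : ℝ}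
    (h : ∀ b, tv (g.prob b) (g'.prob b) ≤ δ) (a : Bits n) :
    tv ((comp f g).prob a) ((comp f g').prob a) ≤ δ := by
  have key := tv_sum_mul_le (f.prob a) (f.nonneg a) g.prob g'.prob
  simp only [comp, mul_comm _ (f.prob a _)]
  refine key.trans ((Finset.sum_le_sum fun b _ =>
    mul_le_mul_of_nonneg_left (h b) (f.nonneg a b)).trans_eq ?_)
  rw [← Finset.sum_mul, f.sum_one, one_mul]

theorem tv_tensor_left {n m k l : ℕ} (f f' : Hom n m) (g : Hom k l) (x : Bits (n + k)) :
    tv ((tensor f g).prob x) ((tensor f' g).prob x) =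
      tv (f.prob (fstBits x)) (f'.prob (fstBits x)) := by
  have h := sum_bits_add (n := m) (m := l) fun u v =>
    |f.prob (fstBits x) u * g.prob (sndBits x) v - f'.prob (fstBits x) u * g.prob (sndBits x) v| / 2
  refine h.trans (Finset.sum_congr rfl fun u _ => ?_)
  simp only [← sub_mul, abs_mul, abs_of_nonneg (g.nonneg _ _), mul_div_right_comm]
  rw [← Finset.mul_sum, g.sum_one, mul_one]

theorem tv_tensor_right {n m k l : ℕ} (f : Hom n m) (g g' : Hom k l) (x : Bits (n + k)) :
    tv ((tensor f g).prob x) ((tensor f g').prob x) =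
      tv (g.prob (sndBits x)) (g'.prob (sndBits x)) := by
  have h := sum_bits_add (n := m) (m := l) fun u v =>
    |f.prob (fstBits x) u * g.prob (sndBits x) v - f.prob (fstBits x) u * g'.prob (sndBits x) v| / 2
  refine h.trans ?_
  rw [Finset.sum_comm]
  refine Finset.sum_congr rfl fun v _ => ?_
  simp only [← mul_sub, abs_mul, abs_of_nonneg (f.nonneg _ _), mul_div_assoc]
  rw [← Finset.sum_mul, f.sum_one, one_mul]

/-- The two-point case of `tv_sum_mul_le`, with weights indexed by `Bool`. -/
theorem tv_convex_le {m : ℕ} (p : unitInterval) (v v' w w' : Bits m → ℝ) :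
    tv (fun c => p * v c + (1 - p) * w c) (fun c => p * v' c + (1 - p) * w' c) ≤
      p * tv v v' + (1 - p) * tv w w' := by
  have h := tv_sum_mul_le (fun i : Bool => if i = true then (p : ℝ) else 1 - p)
    (fun i => by
      cases i
      · simpa using p.2.2
      · simpa using p.2.1)
    (fun i => if i = true then v else w) (fun i => if i = true then v' else w')
  simpa using h

theorem dist_le_iff {n m : ℕ} {f g : Hom n m} {δ : ℝ} :
    dist f g ≤ δ ↔ ∀ a, tv (f.prob a) (g.prob a) ≤ δ := by
  simp [dist, Finset.sup'_le_iff]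

theorem tv_prob_le_dist {n m : ℕ} (f g : Hom n m) (a : Bits n) :
    tv (f.prob a) (g.prob a) ≤ dist f g :=
  dist_le_iff.1 le_rfl a

theorem dist_nonneg {n m : ℕ} (f g : Hom n m) : 0 ≤ dist f g :=
  (tv_nonneg _ _).trans (tv_prob_le_dist f g fun _ => true)

theorem dist_le_one {n m : ℕ} (f g : Hom n m) : dist f g ≤ 1 :=
  dist_le_iff.2 (tv_prob_le_one f g)

theorem eq_of_tv_eq_zero {m : ℕ} {v w : Bits m → ℝ} (h : tv v w = 0) : v = w := by
  funext b
  have hb := (Finset.sum_eq_zero_iff_of_nonneg fun b _ => by positivity).1 h b (Finset.mem_univ b)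
  have : |v b - w b| = 0 := by linarith
  exact sub_eq_zero.1 (abs_eq_zero.1 this)

theorem eq_of_dist_eq_zero {n m : ℕ} {f g : Hom n m} (h : dist f g = 0) : f = g := by
  refine Hom.ext (funext fun a => eq_of_tv_eq_zero ?_)
  exact le_antisymm (h ▸ tv_prob_le_dist f g a) (tv_nonneg _ _)

/-- The bound must hold at every input for the induction to close: the tensor and gate rules use it
at parts of `a`, and `compRight` at all intermediate words. -/
theorem Derivable.sound {n m : ℕ} {δ : ℝ} {f g : Hom n m} (h : Derivable δ f g) (a : Bits n) :
    tv (f.prob a) (g.prob a) ≤ δ := by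
  induction h with
  | refl f => exact (tv_self _).le
  | top f g => exact tv_prob_le_one f g a
  | symm _ ih => exact (tv_comm _ _).trans_le (ih a)
  | triangle _ _ ih ih' => exact (tv_triangle _ _ _).trans (add_le_add (ih a) (ih' a))
  | weaken _ hδ ih => exact (ih a).trans hδ
  | compLeft g _ ih => exact (tv_comp_left_le _ _ g a).trans (ih a)
  | compRight f _ ih => exact tv_comp_right_le f ih a
  | tensorLeft g _ ih => exact (tv_tensor_left _ _ g a).trans_le (ih _)
  | tensorRight f _ ih => exact (tv_tensor_right f _ _ a).trans_le (ih _)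
  | phi _ _ ih ih' =>
    simp only [funext (ifGate_prob _ _ a)]
    cases sndBits (fstBits a) 0
    · simpa using ih' _
    · simpa using ih _
  | phiP p _ _ ih ih' =>
    simp only [funext (choice_prob p _ _ a)]
    exact (tv_convex_le p _ _ _ _).trans (add_le_add
      (mul_le_mul_of_nonneg_left (ih _) p.2.1)
      (mul_le_mul_of_nonneg_left (ih' _) (sub_nonneg.2 p.2.2)))

/-! ### Completeness: splitting off the common part -/

theorem sum_min_prob {n m : ℕ} (f g : Hom n m) (a : Bits n) :
    ∑ b, min (f.prob a b) (g.prob a b) = 1 - tv (f.prob a) (g.prob a) := by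
  have h : ∑ b, (f.prob a b + g.prob a b) / 2 = 1 := by
    rw [← Finset.sum_div, Finset.sum_add_distrib, f.sum_one, g.sum_one]
    norm_num
  rw [tv, ← h, ← Finset.sum_sub_distrib]
  refine Finset.sum_congr rfl fun b _ => ?_
  rcases le_total (f.prob a b) (g.prob a b) with h | h
  · rw [min_eq_left h, abs_of_nonpos (sub_nonpos.2 h)]
    ring
  · rw [min_eq_right h, abs_of_nonneg (sub_nonneg.2 h)]
    ring

/-- The normalized overlap of `f` and `g`. -/
def overlap {n m : ℕ} (f g : Hom n m) (h : dist f g < 1) : Hom n m where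
  prob a b := min (f.prob a b) (g.prob a b) / (1 - tv (f.prob a) (g.prob a))
  nonneg a b := div_nonneg (le_min (f.nonneg a b) (g.nonneg a b))
    (sub_nonneg.2 (tv_prob_le_one f g a))
  sum_one a := by
    rw [← Finset.sum_div, sum_min_prob]
    exact div_self (sub_pos.2 ((tv_prob_le_dist f g a).trans_lt h)).ne'

/-- The normalizing mass at `a` is at least 1 - d(f, g), so one weight 1 - d(f, g) works uniformly
in the input, as a single coin requires. -/
theorem one_sub_dist_mul_overlap_le {n m : ℕ} (f g : Hom n m) (h : dist f g < 1) (a : Bits n)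
    (b : Bits m) : (1 - dist f g) * (overlap f g h).prob a b ≤ min (f.prob a b) (g.prob a b) := by
  have h1 := tv_prob_le_dist f g a
  have h2 : 0 < 1 - tv (f.prob a) (g.prob a) := sub_pos.2 (h1.trans_lt h)
  simp only [overlap]
  rw [mul_div_assoc', div_le_iff₀ h2, mul_comm]
  exact mul_le_mul_of_nonneg_left (by linarith) (le_min (f.nonneg a b) (g.nonneg a b))

/-- If `f` dominates `(1 - t) u`, then `residual` is the morphism `r` with
`f = t r + (1 - t) u`. -/
def residual {n m : ℕ} (f u : Hom n m) {t : ℝ} (ht : 0 < t)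
    (h : ∀ a b, (1 - t) * u.prob a b ≤ f.prob a b) : Hom n m where
  prob a b := (f.prob a b - (1 - t) * u.prob a b) / t
  nonneg a b := div_nonneg (sub_nonneg.2 (h a b)) ht.le
  sum_one a := by
    rw [← Finset.sum_div, Finset.sum_sub_distrib, ← Finset.mul_sum, f.sum_one, u.sum_one]
    field_simp
    ring

/-- The diagonal `x ↦ |x, x⟩`. -/
def diag (n : ℕ) : Hom n (n + n) := det fun x => Fin.append x x

theorem diag_choice_residual {n m : ℕ} (f u : Hom n m) (p : unitInterval) (hp : 0 < (p : ℝ))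
    (h : ∀ a b, (1 - (p : ℝ)) * u.prob a b ≤ f.prob a b) :
    comp (diag n) (comp (tensor (residual f u hp h) u) (phiP p m)) = f := by
  ext a b
  have h1 : fstBits (Fin.append a a) = a := funext fun i => Fin.append_left a a i
  have h2 : sndBits (Fin.append a a) = a := funext fun i => Fin.append_right a a i
  rw [diag, comp_det_prob, choice_prob, h1, h2]
  simp only [residual]
  field_simp
  ring

theorem derivable_dist {n m : ℕ} (f g : Hom n m) : Derivable (dist f g) f g := by
  -- The extreme distances are separate: `residual` divides by the distance, and the mass
  -- normalizing `overlap` vanishes at some input when the distance is 1.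
  rcases (dist_nonneg f g).eq_or_lt with h0 | h0
  · rw [← h0, eq_of_dist_eq_zero h0.symm]
    exact .refl g
  rcases (dist_le_one f g).eq_or_lt with h1 | h1
  · rw [h1]
    exact .top f g
  let p : unitInterval := ⟨dist f g, h0.le, h1.le⟩
  let u := overlap f g h1
  have hf : ∀ a b, (1 - (p : ℝ)) * u.prob a b ≤ f.prob a b := fun a b =>
    (one_sub_dist_mul_overlap_le f g h1 a b).trans (min_le_left _ _)
  have hg : ∀ a b, (1 - (p : ℝ)) * u.prob a b ≤ g.prob a b := fun a b =>
    (one_sub_dist_mul_overlap_le f g h1 a b).trans (min_le_right _ _)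
  -- The resulting bound is p · 1 + (1 - p) · 0 = p.
  have key := Derivable.compRight (diag n) (Derivable.phiP p
    (.top (residual f u h0 hf) (residual g u h0 hg)) (.refl u))
  rw [diag_choice_residual f u p h0 hf, diag_choice_residual g u p h0 hg] at key
  simpa [p] using key

end FinStochBool

end

theorem mainTheorem2 :
    (∀ (n m : ℕ) (f g : FinStochBool.Hom n m) (δ : ℝ),
      FinStochBool.Derivable δ f g → FinStochBool.dist f g ≤ δ) ∧
    (∀ (n m : ℕ) (f g : FinStochBool.Hom n m),
      FinStochBool.Derivable (FinStochBool.dist f g) f g) :=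
  ⟨fun _ _ _ _ _ h => FinStochBool.dist_le_iff.2 h.sound,
    fun _ _ f g => FinStochBool.derivable_dist f g⟩
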